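/- Let $A,B\in\mathbb R$ with $A\ge 0$, $A+B\ge 0$ and $(A,B)\ne(0,0)$, and let $\theta(t)=1$ for $t\ge 0$, $\theta(t)=0$ for $t<0$. For $a>0$ and an integer $n\ge 0$ let $$D_n(a)=\det\left(\int_{-\infty}^{\infty}x^{i+j}e^{-x^2}\bigl(A+B\,\theta(x^2-a^2)\bigr)\,dx\right)_{i,j=0}^{n-1}\qquad(D_0:=1).$$ Then all these moments converge absolutely, $D_n(a)>0$ and $\ln D_n$ is differentiable on $(0,\infty)$, the function $$\sigma_n(a)=a\,\frac{d}{da}\ln D_n(a)$$ is twice continuously differentiable on $(0,\infty)$, and for every $a>0$ it satisfies the second-order fourth-degree ordinary differential equation $$\begin{aligned}&\Bigl[16a^6-a^2(\sigma_n'')^2-4(a^4+\sigma_n-a\sigma_n')\bigl(4a^2+8n(\sigma_n-a\sigma_n')-(\sigma_n')^2\bigr)\Bigr]^2\\&\quad=16\Bigl[4(a^4+\sigma_n-a\sigma_n')(a\sigma_n'-2\sigma_n)^2+4a^2\sigma_n''(a\sigma_n'-\sigma_n)-a^4(\sigma_n'')^2\Bigr]\\&\qquad\cdot\Bigl[4(2a^2n+\sigma_n)(a^4+\sigma_n-a\sigma_n')+4a^4-a^2\sigma_n''\Bigr],\end{aligned}$$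 where primes denote derivatives with respect to $a$. -/

import Mathlib

noncomputable section

/-- The Heaviside step function, with value `1` at the jump. -/
def stepFn (t : ℝ) : ℝ := if 0 ≤ t then 1 else 0

/-- The Gaussian weight with jumps at `a` and `-a`:
`w(x; a) = exp(-x²) (A + B θ(x² - a²))`. -/
def jumpWeight (A B a x : ℝ) : ℝ :=
  Real.exp (-x ^ 2) * (A + B * stepFn (x ^ 2 - a ^ 2))

/-- The `n × n` Hankel determinant `D_n(a)` of the moments of the weight over the real line
(equal to `1` for `n = 0`). -/
def hankelD (A B : ℝ) (n : ℕ) (a : ℝ) : ℝ :=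
  Matrix.det (Matrix.of fun i j : Fin n =>
    ∫ x : ℝ, x ^ ((i : ℕ) + (j : ℕ)) * jumpWeight A B a x)

/-- `σ_n(a) = a (d/da) ln D_n(a)`. -/
def sigmaFn (A B : ℝ) (n : ℕ) (a : ℝ) : ℝ :=
  a * deriv (fun b : ℝ => Real.log (hankelD A B n b)) a

end

/-!
The proof follows the ladder-operator method for the monic orthogonal polynomials `Pₙ` of the
weight, with squared norms `hₙ`. Since the weight is even, `Pₙ₊₁ = x Pₙ - βₙ Pₙ₋₁` with
`βₙ = hₙ / hₙ₋₁`, and `Dₙ = ∏_{j < n} hⱼ` (`det_hankel_eq_prod`). Put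
`Rₙ = B exp(-a²) Pₙ(a)² / hₙ` and `rₙ = B exp(-a²) Pₙ(a) Pₙ₋₁(a) / hₙ₋₁`.

Moving the jumps changes `ln hₙ` at the rate `-2 Rₙ` (`hasDerivAt_normSqOP`), so
`σₙ = -2 a ∑_{j < n} Rⱼ` and `βₙ' = 2 βₙ (Rₙ₋₁ - Rₙ)`. Integration by parts gives
`βₙ = rₙ + n / 2` (`jumpRecCoeff_eq`), and the three-term recurrence at `x = a` gives
`rₙ₊₁ + rₙ = a Rₙ` together with `a (rₙ₊₁ - rₙ) = βₙ₊₁ Rₙ₊₁ - βₙ Rₙ₋₁`. From these, by induction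
on `n`, one obtains

* `σₙ = 4 rₙ² + 4 a² rₙ - 4 a βₙ (Rₙ + Rₙ₋₁)` (`ladder_sum_identity`),
* `σₙ' = 8 a rₙ - 4 βₙ (Rₙ + Rₙ₋₁)` (`hasDerivAt_sigmaFn`).

Hence `σₙ - a σₙ' = 4 rₙ² - 4 a² rₙ`, and differentiating this expresses `rₙ'` through `σₙ''`
and `rₙ`. With `4 (βₙ (Rₙ₋₁ + Rₙ))² - 4 (βₙ (Rₙ₋₁ - Rₙ))² = 16 βₙ rₙ²`, where the two squared
quantities are known from `σₙ'` and `rₙ'`, there is one polynomial relation between `rₙ` and the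
derivatives of `σₙ`. As `rₙ` is a root of a quadratic over the other quantities, multiplying the
relation by its conjugate eliminates `rₙ` (`sigma_form_elimination`). No division by
`2 rₙ - a²` occurs, so its zeros need no separate treatment.

Smoothness in `a` holds because the moments are smooth functions of `a` and the coefficients of the
`Pₙ` are rational functions of the moments with nonvanishing denominators `hₙ`.
-/

noncomputable section
open Polynomial MeasureTheory
open scoped ContDiff

/-! ### Monic orthogonal polynomials of an even positive functional -/

/-- Monic polynomials produced by `P₀ = 1`, `P₁ = X`,
`Pₙ₊₂ = X Pₙ₊₁ - (hₙ₊₁ / hₙ) Pₙ` with `hₖ = L (Pₖ²)`. If `L` is even and positive, these are the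
monic orthogonal polynomials of `L`; evenness is what makes the diagonal recurrence coefficients
vanish. -/
def orthoPoly (L : ℝ[X] →ₗ[ℝ] ℝ) : ℕ → ℝ[X]
  | 0 => 1
  | 1 => X
  | n + 2 => X * orthoPoly L (n + 1) -
      C (L (orthoPoly L (n + 1) * orthoPoly L (n + 1)) / L (orthoPoly L n * orthoPoly L n)) *
        orthoPoly L n

/-- The squared norm `hₙ = L (Pₙ²)`. -/
def normSqOP (L : ℝ[X] →ₗ[ℝ] ℝ) (n : ℕ) : ℝ := L (orthoPoly L n * orthoPoly L n)

/-- The recurrence coefficient `βₙ = hₙ / hₙ₋₁`, with `β₀ = 0`. -/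
def recCoeff (L : ℝ[X] →ₗ[ℝ] ℝ) : ℕ → ℝ
  | 0 => 0
  | n + 1 => normSqOP L (n + 1) / normSqOP L n

/-- The three-term recurrence. For `n = 0` the truncated index `n - 1` is harmless as `β₀ = 0`. -/
theorem orthoPoly_succ (L : ℝ[X] →ₗ[ℝ] ℝ) (n : ℕ) :
    orthoPoly L (n + 1) = X * orthoPoly L n - C (recCoeff L n) * orthoPoly L (n - 1) := by
  cases n with
  | zero => simp [orthoPoly, recCoeff]
  | succ n => simp [orthoPoly, recCoeff, normSqOP]

theorem orthoPoly_monic_natDegree (L : ℝ[X] →ₗ[ℝ] ℝ) (n : ℕ) :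
    (orthoPoly L n).Monic ∧ (orthoPoly L n).natDegree = n := by
  induction n using Nat.strong_induction_on with
  | _ n ih =>
    match n, ih with
    | 0, _ => simp [orthoPoly]
    | 1, _ => simp [orthoPoly, monic_X]
    | n + 2, ih =>
      obtain ⟨hm, hd⟩ := ih (n + 1) (by omega)
      obtain ⟨hm', hd'⟩ := ih n (by omega)
      have hX : (X * orthoPoly L (n + 1)).Monic := monic_X.mul hm
      have hXd : (X * orthoPoly L (n + 1)).natDegree = n + 2 := by
        rw [monic_X.natDegree_mul hm, hd, natDegree_X]; omega
      have hlt : (C (L (orthoPoly L (n + 1) * orthoPoly L (n + 1)) /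
          L (orthoPoly L n * orthoPoly L n)) * orthoPoly L n).degree
            < (X * orthoPoly L (n + 1)).degree := by
        refine lt_of_le_of_lt (degree_le_natDegree.trans
          (Nat.cast_le.mpr ((natDegree_C_mul_le _ _).trans hd'.le))) ?_
        rw [degree_eq_natDegree hX.ne_zero, hXd]
        exact_mod_cast (by omega : n < n + 2)
      rw [orthoPoly]
      refine ⟨hX.sub_of_left hlt, ?_⟩
      rw [natDegree_eq_of_degree_eq (degree_sub_eq_left_of_degree_lt hlt), hXd]

theorem orthoPoly_monic (L : ℝ[X] →ₗ[ℝ] ℝ) (n : ℕ) : (orthoPoly L n).Monic :=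
  (orthoPoly_monic_natDegree L n).1

theorem orthoPoly_natDegree (L : ℝ[X] →ₗ[ℝ] ℝ) (n : ℕ) : (orthoPoly L n).natDegree = n :=
  (orthoPoly_monic_natDegree L n).2

theorem orthoPoly_comp_neg_X (L : ℝ[X] →ₗ[ℝ] ℝ) (n : ℕ) :
    (orthoPoly L n).comp (-X) = (-1) ^ n * orthoPoly L n := by
  induction n using Nat.strong_induction_on with
  | _ n ih =>
    match n, ih with
    | 0, _ => simp [orthoPoly]
    | 1, _ => simp [orthoPoly]
    | n + 2, ih =>
      rw [orthoPoly, sub_comp, mul_comp, mul_comp, ih (n + 1) (by omega), ih n (by omega),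
        X_comp, C_comp]
      ring

theorem orthoPoly_eval_neg (L : ℝ[X] →ₗ[ℝ] ℝ) (n : ℕ) (x : ℝ) :
    (orthoPoly L n).eval (-x) = (-1) ^ n * (orthoPoly L n).eval x := by
  have h := congrArg (eval x) (orthoPoly_comp_neg_X L n)
  simpa [eval_comp] using h

/-- A linear functional on polynomials is positive if it is positive on nonzero squares. -/
def IsPosFunctional (L : ℝ[X] →ₗ[ℝ] ℝ) : Prop := ∀ p : ℝ[X], p ≠ 0 → 0 < L (p * p)

/-- A linear functional on polynomials is even if it is invariant under `X ↦ -X`. -/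
def IsEvenFunctional (L : ℝ[X] →ₗ[ℝ] ℝ) : Prop := ∀ p : ℝ[X], L (p.comp (-X)) = L p

section Orthogonality

variable {L : ℝ[X] →ₗ[ℝ] ℝ}

theorem normSqOP_pos (hpos : IsPosFunctional L) (n : ℕ) : 0 < normSqOP L n :=
  hpos _ (orthoPoly_monic L n).ne_zero

theorem map_mul_eq_zero_of_degree_lt {p : ℝ[X]} {n : ℕ} (h : ∀ m < n, L (p * X ^ m) = 0)
    {q : ℝ[X]} (hq : q.degree < n) : L (p * q) = 0 := by
  rcases eq_or_ne q 0 with rfl | hq0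
  · simp
  have hs : p * q = ∑ m ∈ Finset.range n, q.coeff m • (p * X ^ m) := by
    conv_lhs => rw [q.as_sum_range' n ((natDegree_lt_iff_degree_lt hq0).mpr hq), Finset.mul_sum]
    refine Finset.sum_congr rfl fun m _ => ?_
    rw [← C_mul_X_pow_eq_monomial, smul_eq_C_mul]; ring
  rw [hs, map_sum]
  refine Finset.sum_eq_zero fun m hm => ?_
  rw [map_smul, h m (Finset.mem_range.mp hm), smul_zero]

theorem map_mul_eq_of_monic {p : ℝ[X]} {n : ℕ} (h : ∀ m < n, L (p * X ^ m) = 0)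
    {q r : ℝ[X]} (hq : q.Monic) (hqn : q.natDegree = n) (hr : r.Monic) (hrn : r.natDegree = n) :
    L (p * q) = L (p * r) := by
  rw [← sub_eq_zero, ← map_sub, ← mul_sub]
  refine map_mul_eq_zero_of_degree_lt h ?_
  have hd : q.degree = r.degree := by
    rw [degree_eq_natDegree hq.ne_zero, degree_eq_natDegree hr.ne_zero, hqn, hrn]
  have := degree_sub_lt_left hd hq.ne_zero (by rw [hq.leadingCoeff, hr.leadingCoeff])
  rwa [degree_eq_natDegree hq.ne_zero, hqn] at this

theorem map_orthoPoly_mul_X_pow_eq_zero (hpos : IsPosFunctional L) (heven : IsEvenFunctional L)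
    (n : ℕ) : ∀ m < n, L (orthoPoly L n * X ^ m) = 0 := by
  induction n using Nat.strong_induction_on with
  | _ n ih =>
    intro m hmn
    -- by parity only exponents `m` with `n - m` even matter
    rcases Nat.even_or_odd (n + m) with hpar | hpar
    · match n, ih with
      | 0, _ => omega
      | 1, _ =>
        obtain rfl : m = 0 := by omega
        exact absurd hpar (by decide)
      | n + 2, ih =>
        have hne : m ≠ n + 1 := by
          rintro rfl
          exact (Nat.not_even_iff_odd.mpr (by exact ⟨n + 1, by omega⟩)) hpar
        have hexp : orthoPoly L (n + 2) * X ^ m = orthoPoly L (n + 1) * X ^ (m + 1) -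
            (normSqOP L (n + 1) / normSqOP L n) • (orthoPoly L n * X ^ m) := by
          rw [orthoPoly, smul_eq_C_mul, normSqOP, normSqOP]; ring
        rw [hexp, map_sub, map_smul, smul_eq_mul]
        rcases (by omega : m < n ∨ m = n) with hlt | rfl
        · rw [ih (n + 1) (by omega) (m + 1) (by omega), ih n (by omega) m hlt]; ring
        · have h1 : L (orthoPoly L (m + 1) * X ^ (m + 1)) = normSqOP L (m + 1) :=
            map_mul_eq_of_monic (ih (m + 1) (by omega)) (monic_X_pow _) (natDegree_X_pow _)
              (orthoPoly_monic L _) (orthoPoly_natDegree L _)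
          have h2 : L (orthoPoly L m * X ^ m) = normSqOP L m :=
            map_mul_eq_of_monic (ih m (by omega)) (monic_X_pow _) (natDegree_X_pow _)
              (orthoPoly_monic L _) (orthoPoly_natDegree L _)
          rw [h1, h2, div_mul_cancel₀ _ (normSqOP_pos hpos m).ne', sub_self]
    · have h := heven (orthoPoly L n * X ^ m)
      have h2 : (orthoPoly L n * X ^ m).comp (-X) = -(orthoPoly L n * X ^ m) := by
        rw [mul_comp, orthoPoly_comp_neg_X, X_pow_comp, neg_pow (X : ℝ[X]) m]
        calc (-1) ^ n * orthoPoly L n * ((-1) ^ m * X ^ m)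
            = (-1) ^ (n + m) * (orthoPoly L n * X ^ m) := by ring
          _ = _ := by rw [hpar.neg_one_pow]; ring
      rw [h2, map_neg] at h
      linarith

theorem map_orthoPoly_mul_of_degree_lt (hpos : IsPosFunctional L) (heven : IsEvenFunctional L)
    {n : ℕ} {q : ℝ[X]} (hq : q.degree < n) : L (orthoPoly L n * q) = 0 :=
  map_mul_eq_zero_of_degree_lt (map_orthoPoly_mul_X_pow_eq_zero hpos heven n) hq

theorem map_orthoPoly_mul_of_monic (hpos : IsPosFunctional L) (heven : IsEvenFunctional L)
    {n : ℕ} {q : ℝ[X]} (hq : q.Monic) (hqn : q.natDegree = n) :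
    L (orthoPoly L n * q) = normSqOP L n :=
  map_mul_eq_of_monic (map_orthoPoly_mul_X_pow_eq_zero hpos heven n) hq hqn
    (orthoPoly_monic L n) (orthoPoly_natDegree L n)

/-- The Hankel determinant is the product of the squared norms: multiplying the Hankel matrix by
the unitriangular coefficient matrix of the `Pᵢ` gives the matrix `L (Pᵢ Xʲ)`, which is upper
triangular with diagonal `hᵢ`. -/
theorem det_hankel_eq_prod (hpos : IsPosFunctional L) (heven : IsEvenFunctional L) (n : ℕ) :
    Matrix.det (Matrix.of fun i j : Fin n => L (X ^ ((i : ℕ) + (j : ℕ)))) =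
      ∏ i ∈ Finset.range n, normSqOP L i := by
  set M := Matrix.of fun i j : Fin n => L (X ^ ((i : ℕ) + (j : ℕ))) with hM
  let T : Matrix (Fin n) (Fin n) ℝ := Matrix.of fun i j => (orthoPoly L i).coeff j
  have hT : T.det = 1 := by
    rw [Matrix.det_of_isLowerTriangular]
    · refine Finset.prod_eq_one fun i _ => ?_
      have := (orthoPoly_monic L i).coeff_natDegree
      rwa [orthoPoly_natDegree] at this
    · intro i j hij
      refine coeff_eq_zero_of_natDegree_lt ?_
      rw [orthoPoly_natDegree]
      exact hij
  have hTM : ∀ i j : Fin n, (T * M) i j = L (orthoPoly L i * X ^ (j : ℕ)) := by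
    intro i j
    have hs : orthoPoly L i * X ^ (j : ℕ) =
        ∑ k ∈ Finset.range n, (orthoPoly L i).coeff k • (X : ℝ[X]) ^ (k + (j : ℕ)) := by
      conv_lhs => rw [(orthoPoly L i).as_sum_range' n (by
        rw [orthoPoly_natDegree]; exact i.2), Finset.sum_mul]
      refine Finset.sum_congr rfl fun m _ => ?_
      rw [← C_mul_X_pow_eq_monomial, smul_eq_C_mul]; ring
    rw [hs, map_sum, Matrix.mul_apply, ← Fin.sum_univ_eq_sum_range
      (fun k => L ((orthoPoly L i).coeff k • (X : ℝ[X]) ^ (k + (j : ℕ))))]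
    refine Finset.sum_congr rfl fun k _ => ?_
    rw [map_smul, smul_eq_mul]
    rfl
  have hdet : (T * M).det = ∏ i ∈ Finset.range n, normSqOP L i := by
    rw [Matrix.det_of_isUpperTriangular, ← Fin.prod_univ_eq_prod_range]
    · refine Finset.prod_congr rfl fun i _ => ?_
      rw [hTM]
      exact map_orthoPoly_mul_of_monic hpos heven (monic_X_pow _) (natDegree_X_pow _)
    · intro i j hij
      rw [hTM]
      exact map_orthoPoly_mul_X_pow_eq_zero hpos heven _ _ hij
  rw [← hdet, Matrix.det_mul, hT, one_mul]

end Orthogonality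
/-! ### The moment functional of the Gaussian weight with two jumps -/

theorem integrable_eval_mul_exp_neg_sq (p : ℝ[X]) :
    Integrable fun x : ℝ => p.eval x * Real.exp (-x ^ 2) := by
  have hmono : ∀ k : ℕ, Integrable fun x : ℝ => x ^ k * Real.exp (-x ^ 2) := fun k => by
    have h := integrable_rpow_mul_exp_neg_mul_sq (b := 1) one_pos (s := k)
      (by have : (0 : ℝ) ≤ k := Nat.cast_nonneg k
          linarith)
    simpa [Real.rpow_natCast] using h
  have hs : (fun x : ℝ => p.eval x * Real.exp (-x ^ 2)) = fun x =>
      ∑ k ∈ Finset.range (p.natDegree + 1), p.coeff k * (x ^ k * Real.exp (-x ^ 2)) := by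
    funext x
    rw [eval_eq_sum_range, Finset.sum_mul]
    exact Finset.sum_congr rfl fun k _ => by ring
  rw [hs]
  exact integrable_finsetSum _ fun k _ => (hmono k).const_mul _

theorem continuous_eval_mul_exp_neg_sq (p : ℝ[X]) :
    Continuous fun x : ℝ => p.eval x * Real.exp (-x ^ 2) := by fun_prop

/-- The functional `p ↦ ∫ p(x) w(x; a) dx`, with the weight split as
`(A + B) exp(-x²) - B exp(-x²) 𝟙_{|x| < a}`, which displays the dependence on `a` in the limits of
an interval integral. It agrees with the integral against `jumpWeight` for `a > 0`. -/
def momentFunctional (A B a : ℝ) : ℝ[X] →ₗ[ℝ] ℝ where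
  toFun p := (A + B) * (∫ x : ℝ, p.eval x * Real.exp (-x ^ 2)) -
    B * ∫ x in (-a)..a, p.eval x * Real.exp (-x ^ 2)
  map_add' p q := by
    simp only [eval_add, add_mul]
    rw [integral_add (integrable_eval_mul_exp_neg_sq p) (integrable_eval_mul_exp_neg_sq q),
      intervalIntegral.integral_add
        ((continuous_eval_mul_exp_neg_sq p).intervalIntegrable _ _)
        ((continuous_eval_mul_exp_neg_sq q).intervalIntegrable _ _)]
    ring
  map_smul' c p := by
    simp only [eval_smul, smul_eq_mul, mul_assoc, integral_const_mul,
      intervalIntegral.integral_const_mul, RingHom.id_apply]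
    ring

theorem momentFunctional_apply (A B a : ℝ) (p : ℝ[X]) :
    momentFunctional A B a p = (A + B) * (∫ x : ℝ, p.eval x * Real.exp (-x ^ 2)) -
      B * ∫ x in (-a)..a, p.eval x * Real.exp (-x ^ 2) := rfl

theorem jumpWeight_eq_indicator (A B : ℝ) {a : ℝ} (ha : 0 < a) (x : ℝ) :
    jumpWeight A B a x = (A + B) * Real.exp (-x ^ 2) -
      B * (Set.Ioo (-a) a).indicator (fun x => Real.exp (-x ^ 2)) x := by
  unfold jumpWeight stepFn
  by_cases hx : x ∈ Set.Ioo (-a) a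
  · have : ¬ (0 ≤ x ^ 2 - a ^ 2) := by
      have := sq_lt_sq' hx.1 hx.2
      linarith
    rw [if_neg this, Set.indicator_of_mem hx]; ring
  · have : 0 ≤ x ^ 2 - a ^ 2 := by
      by_contra hlt
      exact hx (abs_lt.mp (abs_lt_of_sq_lt_sq (by linarith) ha.le))
    rw [if_pos this, Set.indicator_of_notMem hx]; ring

theorem eval_mul_jumpWeight_eq (A B : ℝ) {a : ℝ} (ha : 0 < a) (p : ℝ[X]) (x : ℝ) :
    p.eval x * jumpWeight A B a x = (A + B) * (p.eval x * Real.exp (-x ^ 2)) -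
      B * (Set.Ioo (-a) a).indicator (fun x => p.eval x * Real.exp (-x ^ 2)) x := by
  rw [jumpWeight_eq_indicator A B ha]
  by_cases hx : x ∈ Set.Ioo (-a) a
  · simp only [Set.indicator_of_mem hx]; ring
  · simp only [Set.indicator_of_notMem hx]; ring

theorem integrable_eval_mul_jumpWeight (A B : ℝ) {a : ℝ} (ha : 0 < a) (p : ℝ[X]) :
    Integrable fun x : ℝ => p.eval x * jumpWeight A B a x := by
  simp only [eval_mul_jumpWeight_eq A B ha]
  exact ((integrable_eval_mul_exp_neg_sq p).const_mul _).sub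
    (((integrable_eval_mul_exp_neg_sq p).indicator measurableSet_Ioo).const_mul _)

theorem integral_eval_mul_jumpWeight (A B : ℝ) {a : ℝ} (ha : 0 < a) (p : ℝ[X]) :
    ∫ x : ℝ, p.eval x * jumpWeight A B a x = momentFunctional A B a p := by
  simp only [eval_mul_jumpWeight_eq A B ha]
  rw [integral_sub ((integrable_eval_mul_exp_neg_sq p).const_mul _)
    (((integrable_eval_mul_exp_neg_sq p).indicator measurableSet_Ioo).const_mul _),
    integral_const_mul, integral_const_mul, integral_indicator measurableSet_Ioo,
    momentFunctional_apply, intervalIntegral.integral_of_le (by linarith),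
    integral_Ioc_eq_integral_Ioo]

theorem isEvenFunctional_momentFunctional (A B a : ℝ) :
    IsEvenFunctional (momentFunctional A B a) := by
  intro p
  have h1 := integral_neg_eq_self (fun x : ℝ => p.eval x * Real.exp (-x ^ 2)) volume
  have h2 := intervalIntegral.integral_comp_neg (a := -a) (b := a)
    (fun x : ℝ => p.eval x * Real.exp (-x ^ 2))
  simp only [neg_neg, even_two.neg_pow] at h1 h2
  simp only [momentFunctional_apply, eval_comp, eval_neg, eval_X, h1, h2]

/-- The hypotheses on `A` and `B` say that the weight is nonnegative and positive on one of the
two open sets `|x| < a` and `|x| > a`; a nonzero polynomial has only finitely many zeros there. -/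
theorem isPosFunctional_momentFunctional {A B : ℝ} (hA : 0 ≤ A) (hAB : 0 ≤ A + B)
    (hne : A ≠ 0 ∨ B ≠ 0) {a : ℝ} (ha : 0 < a) : IsPosFunctional (momentFunctional A B a) := by
  intro p hp
  rw [← integral_eval_mul_jumpWeight A B ha]
  have hnonneg : ∀ x, 0 ≤ jumpWeight A B a x := by
    intro x
    unfold jumpWeight stepFn
    refine mul_nonneg (Real.exp_pos _).le ?_
    split_ifs <;> linarith
  rw [integral_pos_iff_support_of_nonneg _ (integrable_eval_mul_jumpWeight A B ha _)]
  swap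
  · intro x
    have := mul_nonneg (mul_self_nonneg (p.eval x)) (hnonneg x)
    simpa using this
  obtain ⟨s, hs, hsw⟩ : ∃ s : Set ℝ, 0 < volume s ∧ ∀ x ∈ s, jumpWeight A B a x ≠ 0 := by
    rcases hA.eq_or_lt with h0 | hpos
    · subst h0
      refine ⟨Set.Ioi a, by simp, fun x hx => ?_⟩
      have hxa : 0 ≤ x ^ 2 - a ^ 2 := by
        have := pow_le_pow_left₀ ha.le (le_of_lt hx) 2
        linarith
      have hB : B ≠ 0 := by simpa using hne
      rw [jumpWeight, stepFn, if_pos hxa]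
      simp [hB]
    · refine ⟨Set.Ioo (-a) a, by simp [ha], fun x hx => ?_⟩
      have hxa : ¬ (0 ≤ x ^ 2 - a ^ 2) := by
        have := sq_lt_sq' hx.1 hx.2
        linarith
      rw [jumpWeight, stepFn, if_neg hxa]
      simp [hpos.ne']
  have hfin : volume {x : ℝ | p.IsRoot x} = 0 := (finite_setOfPred_isRoot hp).measure_zero _
  rw [← measure_sdiff_null hfin] at hs
  refine lt_of_lt_of_le hs (measure_mono fun x hx => ?_)
  have hx' : p.eval x ≠ 0 := hx.2
  rw [Function.mem_support, eval_mul]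
  exact mul_ne_zero (mul_ne_zero hx' hx') (hsw x hx.1)

/-- Integration by parts: `w' = -2x w + B exp(-a²) (δ_a - δ_{-a})` in the sense of
distributions. -/
theorem momentFunctional_derivative (A B a : ℝ) (p : ℝ[X]) :
    momentFunctional A B a (derivative p) = 2 * momentFunctional A B a (X * p) -
      B * Real.exp (-a ^ 2) * (p.eval a - p.eval (-a)) := by
  have hderiv : ∀ x : ℝ, HasDerivAt (fun x : ℝ => p.eval x * Real.exp (-x ^ 2))
      ((derivative p - C 2 * (X * p)).eval x * Real.exp (-x ^ 2)) x := by
    intro x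
    have h1 : HasDerivAt (fun x : ℝ => Real.exp (-x ^ 2))
        (Real.exp (-x ^ 2) * (-(2 * x))) x := by
      simpa using ((hasDerivAt_pow 2 x).neg).exp
    refine ((p.hasDerivAt x).mul h1).congr_deriv ?_
    simp only [eval_sub, eval_mul, eval_C, eval_X]
    ring
  have h1 : ∫ x : ℝ, (derivative p - C 2 * (X * p)).eval x * Real.exp (-x ^ 2) = 0 :=
    integral_eq_zero_of_hasDerivAt_of_integrable hderiv
      (integrable_eval_mul_exp_neg_sq _) (integrable_eval_mul_exp_neg_sq p)
  have h2 : ∫ x in (-a)..a, (derivative p - C 2 * (X * p)).eval x * Real.exp (-x ^ 2) =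
      p.eval a * Real.exp (-a ^ 2) - p.eval (-a) * Real.exp (-(-a) ^ 2) :=
    intervalIntegral.integral_eq_sub_of_hasDerivAt (fun x _ => hderiv x)
      ((continuous_eval_mul_exp_neg_sq _).intervalIntegrable _ _)
  have h3 : momentFunctional A B a (derivative p - C 2 * (X * p)) =
      -(B * Real.exp (-a ^ 2) * (p.eval a - p.eval (-a))) := by
    rw [momentFunctional_apply, h1, h2, even_two.neg_pow]; ring
  rw [map_sub, ← smul_eq_C_mul, map_smul, smul_eq_mul] at h3
  linarith

/-! ### Dependence on the position of the jump -/

theorem momentFunctional_eq_primitive (A B : ℝ) (p : ℝ[X]) :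
    (fun b => momentFunctional A B b p) = fun b =>
      (A + B) * (∫ x : ℝ, p.eval x * Real.exp (-x ^ 2)) -
        B * ((∫ x in (0 : ℝ)..b, p.eval x * Real.exp (-x ^ 2)) -
          ∫ x in (0 : ℝ)..(-b), p.eval x * Real.exp (-x ^ 2)) := by
  funext b
  have hc := continuous_eval_mul_exp_neg_sq p
  rw [momentFunctional_apply, intervalIntegral.integral_interval_sub_left
    (hc.intervalIntegrable _ _) (hc.intervalIntegrable _ _)]

theorem contDiff_momentFunctional (A B : ℝ) (p : ℝ[X]) :
    ContDiff ℝ ∞ fun b => momentFunctional A B b p := by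
  have hc := continuous_eval_mul_exp_neg_sq p
  have hF : ContDiff ℝ ∞ fun b : ℝ => ∫ x in (0 : ℝ)..b, p.eval x * Real.exp (-x ^ 2) := by
    rw [contDiff_infty_iff_deriv]
    refine ⟨fun b => (hc.integral_hasStrictDerivAt 0 b).hasDerivAt.differentiableAt, ?_⟩
    have : deriv (fun b : ℝ => ∫ x in (0 : ℝ)..b, p.eval x * Real.exp (-x ^ 2)) =
        fun b => p.eval b * Real.exp (-b ^ 2) := funext fun b => hc.deriv_integral _ 0 b
    rw [this]
    exact (by simpa using p.contDiff_aeval (𝕜 := ℝ) ∞ :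
      ContDiff ℝ ∞ fun x : ℝ => p.eval x).mul (by fun_prop)
  rw [momentFunctional_eq_primitive]
  exact contDiff_const.sub (contDiff_const.mul (hF.sub (hF.comp contDiff_neg)))

theorem hasDerivAt_momentFunctional (A B : ℝ) (p : ℝ[X]) (a : ℝ) :
    HasDerivAt (fun b => momentFunctional A B b p)
      (-(B * Real.exp (-a ^ 2) * (p.eval a + p.eval (-a)))) a := by
  have hF : ∀ b : ℝ, HasDerivAt (fun b : ℝ => ∫ x in (0 : ℝ)..b, p.eval x * Real.exp (-x ^ 2))
      (p.eval b * Real.exp (-b ^ 2)) b := fun b =>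
    ((continuous_eval_mul_exp_neg_sq p).integral_hasStrictDerivAt 0 b).hasDerivAt
  have hneg := (hF (-a)).comp a (hasDerivAt_neg a)
  rw [momentFunctional_eq_primitive]
  refine ((((hF a).sub hneg).const_mul B).const_sub _).congr_deriv ?_
  rw [even_two.neg_pow]; ring

theorem momentFunctional_eq_sum (A B b : ℝ) {q : ℝ[X]} {N : ℕ} (hq : q.natDegree < N) :
    momentFunctional A B b q =
      ∑ k ∈ Finset.range N, q.coeff k * momentFunctional A B b (X ^ k) := by
  conv_lhs => rw [q.as_sum_range' N hq, map_sum]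
  refine Finset.sum_congr rfl fun k _ => ?_
  rw [← C_mul_X_pow_eq_monomial, ← smul_eq_C_mul, map_smul, smul_eq_mul]

theorem contDiffAt_coeff_mul {p q : ℝ → ℝ[X]} {a : ℝ}
    (hp : ∀ k, ContDiffAt ℝ ∞ (fun b => (p b).coeff k) a)
    (hq : ∀ k, ContDiffAt ℝ ∞ (fun b => (q b).coeff k) a) (k : ℕ) :
    ContDiffAt ℝ ∞ (fun b => (p b * q b).coeff k) a := by
  simp only [coeff_mul]
  exact ContDiffAt.sum fun x _ => (hp x.1).mul (hq x.2)

theorem contDiffAt_momentFunctional_family (A B : ℝ) {p : ℝ → ℝ[X]} {a : ℝ} {N : ℕ}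
    (hN : ∀ b, (p b).natDegree < N)
    (hp : ∀ k, ContDiffAt ℝ ∞ (fun b => (p b).coeff k) a) :
    ContDiffAt ℝ ∞ (fun b => momentFunctional A B b (p b)) a := by
  have : (fun b => momentFunctional A B b (p b)) = fun b =>
      ∑ k ∈ Finset.range N, (p b).coeff k * momentFunctional A B b (X ^ k) :=
    funext fun b => momentFunctional_eq_sum A B b (hN b)
  rw [this]
  exact ContDiffAt.sum fun k _ => (hp k).mul (contDiff_momentFunctional A B _).contDiffAt

/-- Only the explicit dependence of the functional on its parameter contributes to the derivative
of `b ↦ (L_b - L_a) (p_b)` at `b = a`. -/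
theorem hasDerivAt_momentFunctional_sub (A B : ℝ) {p : ℝ → ℝ[X]} {a : ℝ} {N : ℕ}
    (hN : ∀ b, (p b).natDegree < N)
    (hp : ∀ k, ContDiffAt ℝ ∞ (fun b => (p b).coeff k) a) :
    HasDerivAt (fun b => momentFunctional A B b (p b) - momentFunctional A B a (p b))
      (-(B * Real.exp (-a ^ 2) * ((p a).eval a + (p a).eval (-a)))) a := by
  have hfun : (fun b => momentFunctional A B b (p b) - momentFunctional A B a (p b)) = fun b =>
      ∑ k ∈ Finset.range N, (p b).coeff k *
        (momentFunctional A B b (X ^ k) - momentFunctional A B a (X ^ k)) := by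
    funext b
    rw [momentFunctional_eq_sum A B b (hN b), momentFunctional_eq_sum A B a (hN b),
      ← Finset.sum_sub_distrib]
    exact Finset.sum_congr rfl fun k _ => by ring
  rw [hfun]
  refine (HasDerivAt.fun_sum fun k _ =>
    (((hp k).differentiableAt (by simp)).hasDerivAt).mul
      ((hasDerivAt_momentFunctional A B (X ^ k) a).sub_const
        (momentFunctional A B a (X ^ k)))).congr_deriv ?_
  rw [eval_eq_sum_range' (hN a), eval_eq_sum_range' (hN a), ← Finset.sum_add_distrib,
    Finset.mul_sum, ← Finset.sum_neg_distrib]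
  refine Finset.sum_congr rfl fun k _ => ?_
  simp only [eval_pow, eval_X]
  ring

theorem contDiffAt_coeff_orthoPoly {A B : ℝ} (hA : 0 ≤ A) (hAB : 0 ≤ A + B)
    (hne : A ≠ 0 ∨ B ≠ 0) {a : ℝ} (ha : 0 < a) (n : ℕ) : ∀ k,
    ContDiffAt ℝ ∞ (fun b => (orthoPoly (momentFunctional A B b) n).coeff k) a := by
  induction n using Nat.strong_induction_on with
  | _ n ih =>
    match n, ih with
    | 0, _ => exact fun k => by simpa only [orthoPoly] using contDiffAt_const
    | 1, _ => exact fun k => by simpa only [orthoPoly] using contDiffAt_const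
    | n + 2, ih =>
      intro k
      have hnorm : ∀ m < n + 2, ContDiffAt ℝ ∞ (fun b => momentFunctional A B b
          (orthoPoly (momentFunctional A B b) m * orthoPoly (momentFunctional A B b) m)) a :=
        fun m hm => contDiffAt_momentFunctional_family A B (N := m + m + 1)
          (fun b => by
            rw [(orthoPoly_monic _ m).natDegree_mul (orthoPoly_monic _ m), orthoPoly_natDegree]
            omega)
          (contDiffAt_coeff_mul (ih m hm) (ih m hm))
      have hne0 := (normSqOP_pos (isPosFunctional_momentFunctional hA hAB hne ha) n).ne'
      simp only [orthoPoly, coeff_sub, coeff_C_mul]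
      exact (contDiffAt_coeff_mul (fun _ => contDiffAt_const) (ih (n + 1) (by omega)) k).sub
        (((hnorm (n + 1) (by omega)).div (hnorm n (by omega)) hne0).mul (ih n (by omega) k))

theorem contDiffAt_normSqOP {A B : ℝ} (hA : 0 ≤ A) (hAB : 0 ≤ A + B)
    (hne : A ≠ 0 ∨ B ≠ 0) {a : ℝ} (ha : 0 < a) (n : ℕ) :
    ContDiffAt ℝ ∞ (fun b => normSqOP (momentFunctional A B b) n) a :=
  contDiffAt_momentFunctional_family A B (N := n + n + 1)
    (fun b => by
      rw [(orthoPoly_monic _ n).natDegree_mul (orthoPoly_monic _ n), orthoPoly_natDegree]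
      omega)
    (contDiffAt_coeff_mul (contDiffAt_coeff_orthoPoly hA hAB hne ha n)
      (contDiffAt_coeff_orthoPoly hA hAB hne ha n))

theorem contDiffAt_eval_orthoPoly {A B : ℝ} (hA : 0 ≤ A) (hAB : 0 ≤ A + B)
    (hne : A ≠ 0 ∨ B ≠ 0) {a : ℝ} (ha : 0 < a) (n : ℕ) :
    ContDiffAt ℝ ∞ (fun b => (orthoPoly (momentFunctional A B b) n).eval b) a := by
  have : (fun b => (orthoPoly (momentFunctional A B b) n).eval b) = fun b =>
      ∑ k ∈ Finset.range (n + 1), (orthoPoly (momentFunctional A B b) n).coeff k * b ^ k := by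
    funext b
    rw [eval_eq_sum_range, orthoPoly_natDegree]
  rw [this]
  exact ContDiffAt.sum fun k _ => (contDiffAt_coeff_orthoPoly hA hAB hne ha n k).mul (by fun_prop)

/-- `hₙ' = -2 B exp(-a²) Pₙ(a)²`. By orthogonality `hₙ(b) - hₙ(a) = (L_b - L_a) (Pₙ(·; b) Pₙ(·; a))`,
so the variation of the polynomials themselves does not enter. -/
theorem hasDerivAt_normSqOP {A B : ℝ} (hA : 0 ≤ A) (hAB : 0 ≤ A + B)
    (hne : A ≠ 0 ∨ B ≠ 0) {a : ℝ} (ha : 0 < a) (n : ℕ) :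
    HasDerivAt (fun b => normSqOP (momentFunctional A B b) n)
      (-2 * (B * Real.exp (-a ^ 2) * (orthoPoly (momentFunctional A B a) n).eval a ^ 2)) a := by
  have hmain := (hasDerivAt_momentFunctional_sub A B (a := a) (N := n + n + 1)
    (p := fun b => orthoPoly (momentFunctional A B b) n * orthoPoly (momentFunctional A B a) n)
    (fun b => by
      rw [(orthoPoly_monic _ n).natDegree_mul (orthoPoly_monic _ n), orthoPoly_natDegree,
        orthoPoly_natDegree]
      omega)
    (contDiffAt_coeff_mul (contDiffAt_coeff_orthoPoly hA hAB hne ha n)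
      fun _ => contDiffAt_const)).add_const (normSqOP (momentFunctional A B a) n)
  refine (hmain.congr_of_eventuallyEq ?_).congr_deriv ?_
  · filter_upwards [lt_mem_nhds ha] with b hb
    rw [map_orthoPoly_mul_of_monic (isPosFunctional_momentFunctional hA hAB hne hb)
      (isEvenFunctional_momentFunctional A B b) (orthoPoly_monic _ n) (orthoPoly_natDegree _ n),
      mul_comm (orthoPoly (momentFunctional A B b) n),
      map_orthoPoly_mul_of_monic (isPosFunctional_momentFunctional hA hAB hne ha)
      (isEvenFunctional_momentFunctional A B a) (orthoPoly_monic _ n) (orthoPoly_natDegree _ n)]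
    ring
  · simp only [eval_mul, orthoPoly_eval_neg]
    have h1 : ((-1 : ℝ) ^ n) * (-1) ^ n = 1 := by rw [← mul_pow]; simp
    linear_combination (-(B * Real.exp (-a ^ 2) *
      (orthoPoly (momentFunctional A B a) n).eval a ^ 2)) * h1

/-! ### Ladder quantities and their difference equations -/

/-- `Rₙ = B exp(-a²) Pₙ(a)² / hₙ`, the residue at `a` of the ladder-operator coefficient `Aₙ(z)`. -/
def ladderR (A B : ℝ) (n : ℕ) (a : ℝ) : ℝ :=
  B * Real.exp (-a ^ 2) * (orthoPoly (momentFunctional A B a) n).eval a ^ 2 /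
    normSqOP (momentFunctional A B a) n

/-- `rₙ = B exp(-a²) Pₙ(a) Pₙ₋₁(a) / hₙ₋₁`, the residue at `a` of the ladder-operator coefficient
`Bₙ(z)`, with `r₀ = 0`. -/
def ladderS (A B : ℝ) (n : ℕ) (a : ℝ) : ℝ :=
  match n with
  | 0 => 0
  | n + 1 => B * Real.exp (-a ^ 2) * (orthoPoly (momentFunctional A B a) (n + 1)).eval a *
      (orthoPoly (momentFunctional A B a) n).eval a / normSqOP (momentFunctional A B a) n

/-- `βₙ = hₙ / hₙ₋₁` as a function of the jump position. -/
def jumpRecCoeff (A B : ℝ) (n : ℕ) (a : ℝ) : ℝ := recCoeff (momentFunctional A B a) n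

theorem eval_orthoPoly_add_two (A B a : ℝ) (n : ℕ) :
    (orthoPoly (momentFunctional A B a) (n + 2)).eval a =
      a * (orthoPoly (momentFunctional A B a) (n + 1)).eval a -
        normSqOP (momentFunctional A B a) (n + 1) / normSqOP (momentFunctional A B a) n *
          (orthoPoly (momentFunctional A B a) n).eval a := by
  rw [orthoPoly_succ]
  simp [recCoeff]

section Algebraic

variable {A B : ℝ} {a : ℝ}

theorem recCoeff_mul_ladderR_mul_ladderR
    (h : ∀ n, normSqOP (momentFunctional A B a) n ≠ 0) (n : ℕ) :
    jumpRecCoeff A B n a * ladderR A B (n - 1) a * ladderR A B n a = ladderS A B n a ^ 2 := by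
  cases n with
  | zero => simp [jumpRecCoeff, recCoeff, ladderS]
  | succ n =>
    have h0 := h n
    have h1 := h (n + 1)
    simp only [jumpRecCoeff, recCoeff, ladderS, ladderR, Nat.add_sub_cancel]
    field_simp

theorem ladderS_succ_add (h : ∀ n, normSqOP (momentFunctional A B a) n ≠ 0) (n : ℕ) :
    ladderS A B (n + 1) a + ladderS A B n a = a * ladderR A B n a := by
  cases n with
  | zero => simp [ladderS, ladderR, orthoPoly]; ring
  | succ n =>
    have h0 := h n
    have h1 := h (n + 1)
    simp only [ladderS, ladderR]
    rw [eval_orthoPoly_add_two]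
    field_simp
    ring

theorem mul_ladderS_succ_sub (h : ∀ n, normSqOP (momentFunctional A B a) n ≠ 0) (n : ℕ) :
    a * (ladderS A B (n + 1) a - ladderS A B n a) =
      jumpRecCoeff A B (n + 1) a * ladderR A B (n + 1) a -
        jumpRecCoeff A B n a * ladderR A B (n - 1) a := by
  cases n with
  | zero =>
    have h0 := h 0
    have h1 := h 1
    simp only [ladderS, ladderR, jumpRecCoeff, recCoeff, orthoPoly, eval_X, eval_one]
    field_simp
    ring
  | succ n =>
    have h0 := h n
    have h1 := h (n + 1)
    have h2 := h (n + 2)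
    simp only [ladderS, ladderR, jumpRecCoeff, recCoeff, Nat.add_sub_cancel, add_assoc,
      Nat.reduceAdd]
    rw [eval_orthoPoly_add_two]
    field_simp
    ring

/-- Integrating `(Pₙ Pₙ₋₁)'` by parts gives `n hₙ₋₁ = 2 hₙ - 2 rₙ hₙ₋₁`. -/
theorem jumpRecCoeff_eq (hA : 0 ≤ A) (hAB : 0 ≤ A + B) (hne : A ≠ 0 ∨ B ≠ 0) (ha : 0 < a)
    (n : ℕ) : jumpRecCoeff A B n a = ladderS A B n a + n / 2 := by
  cases n with
  | zero => simp [jumpRecCoeff, recCoeff, ladderS]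
  | succ n =>
    set L := momentFunctional A B a with hL
    have hpos : IsPosFunctional L := isPosFunctional_momentFunctional hA hAB hne ha
    have heven : IsEvenFunctional L := isEvenFunctional_momentFunctional A B a
    have h0 := (normSqOP_pos hpos n).ne'
    have hibp := momentFunctional_derivative A B a (orthoPoly L (n + 1) * orthoPoly L n)
    rw [← hL, derivative_mul, map_add] at hibp
    have e1 : L (derivative (orthoPoly L (n + 1)) * orthoPoly L n) =
        (n + 1) * normSqOP L n := by
      -- `Pₙ₊₁' - (n + 1) Pₙ` has degree less than `n`
      have hdeg : (derivative (orthoPoly L (n + 1)) - C ((n : ℝ) + 1) * orthoPoly L n).degree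
          < (n : ℕ) := by
        rw [degree_lt_iff_coeff_zero]
        intro m hm
        rw [coeff_sub, coeff_C_mul, coeff_derivative]
        rcases hm.eq_or_lt with rfl | hlt
        · have c1 := (orthoPoly_monic L (n + 1)).coeff_natDegree
          have c2 := (orthoPoly_monic L n).coeff_natDegree
          rw [orthoPoly_natDegree] at c1 c2
          rw [c1, c2]; ring
        · rw [coeff_eq_zero_of_natDegree_lt (by rw [orthoPoly_natDegree]; omega),
            coeff_eq_zero_of_natDegree_lt (by rw [orthoPoly_natDegree]; omega)]
          ring
      have h := map_orthoPoly_mul_of_degree_lt hpos heven hdeg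
      have hexp : orthoPoly L n *
          (derivative (orthoPoly L (n + 1)) - C ((n : ℝ) + 1) * orthoPoly L n) =
          derivative (orthoPoly L (n + 1)) * orthoPoly L n -
            ((n : ℝ) + 1) • (orthoPoly L n * orthoPoly L n) := by
        rw [smul_eq_C_mul]; ring
      rw [hexp, map_sub, map_smul, smul_eq_mul] at h
      rw [normSqOP]
      linarith
    have e2 : L (orthoPoly L (n + 1) * derivative (orthoPoly L n)) = 0 := by
      refine map_orthoPoly_mul_of_degree_lt hpos heven ?_
      refine (degree_derivative_lt (orthoPoly_monic L n).ne_zero).trans ?_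
      rw [degree_eq_natDegree (orthoPoly_monic L n).ne_zero, orthoPoly_natDegree]
      exact_mod_cast Nat.lt_succ_self n
    have e3 : L (X * (orthoPoly L (n + 1) * orthoPoly L n)) = normSqOP L (n + 1) := by
      rw [mul_left_comm]
      refine map_orthoPoly_mul_of_monic hpos heven (monic_X.mul (orthoPoly_monic L n)) ?_
      rw [monic_X.natDegree_mul (orthoPoly_monic L n), natDegree_X, orthoPoly_natDegree]
      omega
    have e4 : ((-1 : ℝ) ^ (n + 1)) * (-1) ^ n = -1 := by
      rw [pow_succ, mul_right_comm, ← mul_pow]; simp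
    rw [e1, e2, e3] at hibp
    simp only [eval_mul, orthoPoly_eval_neg] at hibp
    simp only [jumpRecCoeff, recCoeff, ladderS, ← hL]
    push_cast
    field_simp
    linear_combination (-1) * hibp - B * Real.exp (-a ^ 2) *
      (eval a (orthoPoly L (n + 1)) * eval a (orthoPoly L n)) * e4

/-- The summed compatibility condition of the ladder operators. -/
theorem ladder_sum_identity (hA : 0 ≤ A) (hAB : 0 ≤ A + B) (hne : A ≠ 0 ∨ B ≠ 0) (ha : 0 < a)
    (n : ℕ) :
    2 * ladderS A B n a ^ 2 + 2 * a ^ 2 * ladderS A B n a +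
        a * ∑ j ∈ Finset.range n, ladderR A B j a =
      2 * a * jumpRecCoeff A B n a * (ladderR A B n a + ladderR A B (n - 1) a) := by
  have h : ∀ n, normSqOP (momentFunctional A B a) n ≠ 0 := fun n =>
    (normSqOP_pos (isPosFunctional_momentFunctional hA hAB hne ha) n).ne'
  induction n with
  | zero => simp [ladderS, jumpRecCoeff, recCoeff]
  | succ n ih =>
    have k1 := ladderS_succ_add h n
    have k2 := mul_ladderS_succ_sub h n
    have b1 := jumpRecCoeff_eq hA hAB hne ha n
    have b2 := jumpRecCoeff_eq hA hAB hne ha (n + 1)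
    push_cast at b2
    rw [Finset.sum_range_succ, Nat.add_sub_cancel]
    linear_combination ih + 2 * a * k2 +
      2 * (ladderS A B (n + 1) a - ladderS A B n a) * k1 +
      (-2) * a * ladderR A B n a * (b2 - b1)

end Algebraic

/-! ### Differential equations in the position of the jump -/

theorem hasDerivAt_jumpRecCoeff {A B : ℝ} (hA : 0 ≤ A) (hAB : 0 ≤ A + B)
    (hne : A ≠ 0 ∨ B ≠ 0) {a : ℝ} (ha : 0 < a) (n : ℕ) :
    HasDerivAt (jumpRecCoeff A B n)
      (2 * jumpRecCoeff A B n a * (ladderR A B (n - 1) a - ladderR A B n a)) a := by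
  cases n with
  | zero =>
    have : jumpRecCoeff A B 0 = fun _ => 0 := rfl
    rw [this]
    simpa using hasDerivAt_const a (0 : ℝ)
  | succ n =>
    have h : ∀ n, normSqOP (momentFunctional A B a) n ≠ 0 := fun n =>
      (normSqOP_pos (isPosFunctional_momentFunctional hA hAB hne ha) n).ne'
    have h0 := h n
    have h1 := h (n + 1)
    refine ((hasDerivAt_normSqOP hA hAB hne ha (n + 1)).div
      (hasDerivAt_normSqOP hA hAB hne ha n) h0).congr_deriv ?_
    simp only [jumpRecCoeff, recCoeff, ladderR, Nat.add_sub_cancel]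
    field_simp
    ring

theorem hasDerivAt_ladderS {A B : ℝ} (hA : 0 ≤ A) (hAB : 0 ≤ A + B)
    (hne : A ≠ 0 ∨ B ≠ 0) {a : ℝ} (ha : 0 < a) (n : ℕ) :
    HasDerivAt (ladderS A B n)
      (2 * jumpRecCoeff A B n a * (ladderR A B (n - 1) a - ladderR A B n a)) a := by
  refine ((hasDerivAt_jumpRecCoeff hA hAB hne ha n).sub_const (n / 2 : ℝ)).congr_of_eventuallyEq ?_
  filter_upwards [lt_mem_nhds ha] with b hb
  rw [jumpRecCoeff_eq hA hAB hne hb n]; ring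

theorem hankelD_eq_prod {A B : ℝ} (hA : 0 ≤ A) (hAB : 0 ≤ A + B) (hne : A ≠ 0 ∨ B ≠ 0)
    {a : ℝ} (ha : 0 < a) (n : ℕ) :
    hankelD A B n a = ∏ j ∈ Finset.range n, normSqOP (momentFunctional A B a) j := by
  rw [← det_hankel_eq_prod (isPosFunctional_momentFunctional hA hAB hne ha)
    (isEvenFunctional_momentFunctional A B a)]
  unfold hankelD
  congr 1
  ext i j
  simp only [Matrix.of_apply, ← integral_eval_mul_jumpWeight A B ha, eval_pow, eval_X]

theorem hankelD_pos {A B : ℝ} (hA : 0 ≤ A) (hAB : 0 ≤ A + B) (hne : A ≠ 0 ∨ B ≠ 0)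
    {a : ℝ} (ha : 0 < a) (n : ℕ) : 0 < hankelD A B n a := by
  rw [hankelD_eq_prod hA hAB hne ha]
  exact Finset.prod_pos fun j _ => normSqOP_pos (isPosFunctional_momentFunctional hA hAB hne ha) j

theorem hasDerivAt_log_hankelD {A B : ℝ} (hA : 0 ≤ A) (hAB : 0 ≤ A + B)
    (hne : A ≠ 0 ∨ B ≠ 0) {a : ℝ} (ha : 0 < a) (n : ℕ) :
    HasDerivAt (fun b => Real.log (hankelD A B n b))
      (-2 * ∑ j ∈ Finset.range n, ladderR A B j a) a := by
  have hpos : ∀ b, 0 < b → ∀ j, normSqOP (momentFunctional A B b) j ≠ 0 := fun b hb j =>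
    (normSqOP_pos (isPosFunctional_momentFunctional hA hAB hne hb) j).ne'
  refine ((HasDerivAt.fun_sum (u := Finset.range n) fun j _ =>
    (hasDerivAt_normSqOP hA hAB hne ha j).log (hpos a ha j)).congr_of_eventuallyEq
      ?_).congr_deriv ?_
  · filter_upwards [lt_mem_nhds ha] with b hb
    rw [hankelD_eq_prod hA hAB hne hb, Real.log_prod fun j _ => hpos b hb j]
  · rw [Finset.mul_sum]
    exact Finset.sum_congr rfl fun j _ => by rw [ladderR]; ring

theorem sigmaFn_eq {A B : ℝ} (hA : 0 ≤ A) (hAB : 0 ≤ A + B) (hne : A ≠ 0 ∨ B ≠ 0)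
    {a : ℝ} (ha : 0 < a) (n : ℕ) :
    sigmaFn A B n a = a * (-2 * ∑ j ∈ Finset.range n, ladderR A B j a) := by
  rw [sigmaFn, (hasDerivAt_log_hankelD hA hAB hne ha n).deriv]

theorem contDiffAt_sigmaFn {A B : ℝ} (hA : 0 ≤ A) (hAB : 0 ≤ A + B) (hne : A ≠ 0 ∨ B ≠ 0)
    {a : ℝ} (ha : 0 < a) (n : ℕ) : ContDiffAt ℝ ∞ (sigmaFn A B n) a := by
  have hR : ∀ j, ContDiffAt ℝ ∞ (ladderR A B j) a := fun j =>
    ((ContDiffAt.mul (by fun_prop) ((contDiffAt_eval_orthoPoly hA hAB hne ha j).pow 2)).div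
      (contDiffAt_normSqOP hA hAB hne ha j)
      (normSqOP_pos (isPosFunctional_momentFunctional hA hAB hne ha) j).ne')
  have : ContDiffAt ℝ ∞ (fun b => b * (-2 * ∑ j ∈ Finset.range n, ladderR A B j b)) a :=
    contDiffAt_id.mul (contDiffAt_const.mul (ContDiffAt.sum fun j _ => hR j))
  refine this.congr_of_eventuallyEq ?_
  filter_upwards [lt_mem_nhds ha] with b hb
  exact sigmaFn_eq hA hAB hne hb n

/-- With `a Rⱼ = rⱼ₊₁ + rⱼ` the function `σₙ` becomes `-2 ∑ (rⱼ₊₁ + rⱼ)`, whose derivative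
telescopes. -/
theorem hasDerivAt_sigmaFn {A B : ℝ} (hA : 0 ≤ A) (hAB : 0 ≤ A + B) (hne : A ≠ 0 ∨ B ≠ 0)
    {a : ℝ} (ha : 0 < a) (n : ℕ) :
    HasDerivAt (sigmaFn A B n)
      (8 * a * ladderS A B n a -
        4 * jumpRecCoeff A B n a * (ladderR A B n a + ladderR A B (n - 1) a)) a := by
  have h : ∀ b, 0 < b → ∀ n, normSqOP (momentFunctional A B b) n ≠ 0 := fun b hb n =>
    (normSqOP_pos (isPosFunctional_momentFunctional hA hAB hne hb) n).ne'
  have hsum : HasDerivAt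
      (fun b => -2 * ∑ j ∈ Finset.range n, (ladderS A B (j + 1) b + ladderS A B j b))
      (8 * a * ladderS A B n a -
        4 * jumpRecCoeff A B n a * (ladderR A B n a + ladderR A B (n - 1) a)) a := by
    refine ((HasDerivAt.fun_sum (u := Finset.range n) fun j _ =>
      (hasDerivAt_ladderS hA hAB hne ha (j + 1)).add
        (hasDerivAt_ladderS hA hAB hne ha j)).const_mul (-2)).congr_deriv ?_
    induction n with
    | zero => simp [ladderS, jumpRecCoeff, recCoeff]
    | succ n ih =>
      rw [Finset.sum_range_succ, mul_add, ih, Nat.add_sub_cancel]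
      linear_combination (-8) * mul_ladderS_succ_sub (h a ha) n
  refine hsum.congr_of_eventuallyEq ?_
  filter_upwards [lt_mem_nhds ha] with b hb
  rw [sigmaFn_eq hA hAB hne hb, Finset.sum_congr rfl fun j _ => ladderS_succ_add (h b hb) j,
    ← Finset.mul_sum]
  ring

theorem sigmaFn_sub_mul_deriv {A B : ℝ} (hA : 0 ≤ A) (hAB : 0 ≤ A + B) (hne : A ≠ 0 ∨ B ≠ 0)
    {a : ℝ} (ha : 0 < a) (n : ℕ) :
    sigmaFn A B n a - a * deriv (sigmaFn A B n) a =
      4 * ladderS A B n a ^ 2 - 4 * a ^ 2 * ladderS A B n a := by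
  rw [(hasDerivAt_sigmaFn hA hAB hne ha n).deriv, sigmaFn_eq hA hAB hne ha]
  linear_combination (-2) * ladder_sum_identity hA hAB hne ha n

/-- Elimination of `r`: with `S = 2 r - a²` one has `S² = a⁴ + s - a s'`, and the hypothesis `hE`
has the form `P + Q S = 0` with `P` and `Q` free of `r`; the conclusion is `P² - Q² S² = 0`. -/
theorem sigma_form_elimination {a n r s s' s'' : ℝ}
    (hs : s - a * s' = 4 * r ^ 2 - 4 * a ^ 2 * r)
    (hE : (8 * a * r - s') ^ 2 * (2 * r - a ^ 2) ^ 2 - a ^ 2 * (8 * r - s'') ^ 2 / 4 -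
      16 * (4 * r ^ 3 + 2 * n * r ^ 2) * (2 * r - a ^ 2) ^ 2 = 0) :
    (16 * a ^ 6 - a ^ 2 * s'' ^ 2
        - 4 * (a ^ 4 + s - a * s') * (4 * a ^ 2 + 8 * n * (s - a * s') - s' ^ 2)) ^ 2
      = 16 * (4 * (a ^ 4 + s - a * s') * (a * s' - 2 * s) ^ 2
            + 4 * a ^ 2 * s'' * (a * s' - s) - a ^ 4 * s'' ^ 2)
          * (4 * (2 * a ^ 2 * n + s) * (a ^ 4 + s - a * s')
            + 4 * a ^ 4 - a ^ 2 * s'') := by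
  obtain rfl : s = a * s' + 4 * r ^ 2 - 4 * a ^ 2 * r := by linarith
  -- the conjugate factor `P - Q S` is obtained by replacing `r` with `a² - r`
  linear_combination (16 * ((8 * a * (a ^ 2 - r) - s') ^ 2 * (2 * r - a ^ 2) ^ 2 -
    a ^ 2 * (8 * (a ^ 2 - r) - s'') ^ 2 / 4 -
    16 * (4 * (a ^ 2 - r) ^ 3 + 2 * n * (a ^ 2 - r) ^ 2) * (2 * r - a ^ 2) ^ 2)) * hE

end

theorem theorem4p1 (A B : ℝ) (hA : 0 ≤ A) (hAB : 0 ≤ A + B)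
    (hne : A ≠ 0 ∨ B ≠ 0) (n : ℕ) (a : ℝ) (ha : 0 < a) :
    (∀ k : ℕ, MeasureTheory.Integrable (fun x : ℝ => x ^ k * jumpWeight A B a x)) ∧
    0 < hankelD A B n a ∧
    DifferentiableAt ℝ (fun b : ℝ => Real.log (hankelD A B n b)) a ∧
    ContDiffAt ℝ 2 (sigmaFn A B n) a ∧
    (let s : ℝ := sigmaFn A B n a
     let s' : ℝ := deriv (sigmaFn A B n) a
     let s'' : ℝ := deriv (deriv (sigmaFn A B n)) a
     (16 * a ^ 6 - a ^ 2 * s'' ^ 2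
        - 4 * (a ^ 4 + s - a * s') * (4 * a ^ 2 + 8 * (n : ℝ) * (s - a * s') - s' ^ 2)) ^ 2
      = 16 * (4 * (a ^ 4 + s - a * s') * (a * s' - 2 * s) ^ 2
            + 4 * a ^ 2 * s'' * (a * s' - s) - a ^ 4 * s'' ^ 2)
          * (4 * (2 * a ^ 2 * (n : ℝ) + s) * (a ^ 4 + s - a * s')
            + 4 * a ^ 4 - a ^ 2 * s'')) := by
  have hC2 : ContDiffAt ℝ 2 (sigmaFn A B n) a :=
    contDiffAt_infty.mp (contDiffAt_sigmaFn hA hAB hne ha n) 2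
  refine ⟨fun k => ?_, hankelD_pos hA hAB hne ha n,
    (hasDerivAt_log_hankelD hA hAB hne ha n).differentiableAt, hC2, ?_⟩
  · simpa using integrable_eval_mul_jumpWeight A B ha (Polynomial.X ^ k)
  intro s s' s''
  have hσ := hasDerivAt_sigmaFn hA hAB hne ha n
  have hσ' : deriv (sigmaFn A B n) a = _ := hσ.deriv
  have hdiff : HasDerivAt (deriv (sigmaFn A B n)) s'' a := by
    have h1 : ContDiffAt ℝ 1 (deriv (sigmaFn A B n)) a := hC2.derivWithin (by norm_num)
    exact (h1.differentiableAt one_ne_zero).hasDerivAt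
  have hr := hasDerivAt_ladderS hA hAB hne ha n
  have hβ := jumpRecCoeff_eq hA hAB hne ha n
  have hprod := recCoeff_mul_ladderR_mul_ladderR (A := A) (B := B) (a := a) (fun m =>
    (normSqOP_pos (isPosFunctional_momentFunctional hA hAB hne ha) m).ne') n
  -- differentiate `σ - a σ' = 4 r² - 4 a² r`
  have hd1 : HasDerivAt (fun b => sigmaFn A B n b - b * deriv (sigmaFn A B n) b)
      (-(a * s'')) a := by
    refine (hσ.sub ((hasDerivAt_id a).mul hdiff)).congr_deriv ?_
    simp only [id, hσ']
    ring
  have hd2 := ((hr.pow 2).const_mul 4).sub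
    ((((hasDerivAt_pow 2 a).const_mul 4)).mul hr)
  have heq := hd1.unique (hd2.congr_of_eventuallyEq (by
    filter_upwards [lt_mem_nhds ha] with b hb
    rw [sigmaFn_sub_mul_deriv hA hAB hne hb n]
    simp))
  have hs' : s' = 8 * a * ladderS A B n a -
      4 * jumpRecCoeff A B n a * (ladderR A B n a + ladderR A B (n - 1) a) := hσ'
  refine sigma_form_elimination (r := ladderS A B n a) (sigmaFn_sub_mul_deriv hA hAB hne ha n) ?_
  rw [hs']
  set r := ladderS A B n a
  set β := jumpRecCoeff A B n a
  set R := ladderR A B n a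
  set R' := ladderR A B (n - 1) a
  -- `4 (2 r - a²) r' = a (8 r - σ'')`
  have hr' : a * (8 * r - s'') = 4 * (2 * r - a ^ 2) * (2 * β * (R' - R)) := by
    push_cast at heq
    linear_combination heq
  have hβr : (n : ℝ) = 2 * β - 2 * r := by linarith
  rw [hβr]
  linear_combination (-(1 / 4) * (a * (8 * r - s'') + 4 * (2 * r - a ^ 2) * (2 * β * (R' - R)))) *
    hr' + 64 * β * (2 * r - a ^ 2) ^ 2 * hprod
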